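/- Let $p,q\ge 0$, let $\lambda_1,\dots,\lambda_p\in\mathbb R$ be pairwise distinct, and let $\Lambda_k=\begin{pmatrix}\alpha_k&-\beta_k\\ \beta_k&\alpha_k\end{pmatrix}$ ($1\le k\le q$) be pairwise distinct real matrices with $\beta_k>0$. For each $i$ let $m^i=(m^i_1,\dots,m^i_{r_i})$ and for each $k$ let $n^k=(n^k_1,\dots,n^k_{s_k})$ be finite tuples of positive integers; put $m=\sum_{i,a}m^i_a$ and $n=\sum_{k,b}n^k_b$. Let $J_N(\lambda)$ be the $N\times N$ upper Jordan cell ($\lambda$ on the diagonal, $1$ on the superdiagonal) and $J_N(\Lambda)$ the $2N\times2N$ matrix with $2\times 2$ blocks $\Lambda$ on the block diagonal, $I_2$ on the block superdiagonal, and $0$ elsewhere. For a tuple $(N_1,\dots,N_t)$ put $J_{N_1,\dots,N_t}(\cdot)=\operatorname{diag}(J_{N_1}(\cdot),\dots,J_{N_t}(\cdot))$, and let $$J=\operatorname{diag}\bigl(J_{m^1}(\lambda_1),\dots,J_{m^p}(\lambda_p),J_{n^1}(\Lambda_1),\dots,J_{n^q}(\Lambda_q)\bigr)$$ be the corresponding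 generalized real Jordan matrix, of order $m+2n$. Explicit blocks. For real constants $C_1,\dots,C_N$ let $g_N(\lambda)(\xi)$ be the $N\times N$ matrix whose $(a,b)$ entry is $X_{a+b-1}(\xi)$ if $a+b\le N+1$ and $0$ otherwise, where $$X_l(\xi)=e^{\lambda\xi}\sum_{j=0}^{N-l}\frac{\xi^j}{j!}C_{l+j}.$$ For $\Lambda=\begin{pmatrix}\alpha&-\beta\\ \beta&\alpha\end{pmatrix}$ and real constants $C_1,\dots,C_N,D_1,\dots,D_N$ let $g_N(\Lambda)(\xi)$ be the $2N\times 2N$ matrix whose $(a,b)$ block of size $2\times2$ is $Z_{a+b-1}(\xi)$ if $a+b\le N+1$ and $0$ otherwise, where $Z_l=\begin{pmatrix}X_l&Y_l\\Y_l&-X_l\end{pmatrix}$ and $$X_l(\xi)=e^{\alpha\xi}\cos(\beta\xi)\sum_{j=0}^{N-l}\frac{\xi^j}{j!}C_{l+j}-e^{\alpha\xi}\sin(\beta\xi)\sum_{j=0}^{N-l}\frac{\xi^j}{j!}D_{l+j},$$ $$Y_l(\xi)=e^{\alpha\xi}\cos(\beta\xi)\sum_{j=0}^{N-l}\frac{\xi^j}{j!}D_{l+j}+e^{\alpha\xi}\sin(\beta\xi)\sum_{j=0}^{N-l}\frac{\xi^j}{j!}C_{l+j}.$$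 For a tuple $(N_1,\dots,N_t)$ let $g_{N_1,\dots,N_t}(\lambda)$ (respectively $g_{N_1,\dots,N_t}(\Lambda)$) be the block matrix $(X_{ab})_{1\le a,b\le t}$ with $X_{ab}$ of size $N_a\times N_b$ (respectively $2N_a\times 2N_b$), where $X_{ab}$ carries the matrix $g_{\min(N_a,N_b)}(\lambda)$ (respectively $g_{\min(N_a,N_b)}(\Lambda)$), with constants depending on the pair $(a,b)$ and equal for $(a,b)$ and $(b,a)$, in its upper left corner and zeros elsewhere. Thus $X_{ab}$ is $g_{N_a}$ if $N_a=N_b$, $[\,g_{N_a}\ \ 0\,]$ if $N_a<N_b$, $\begin{bmatrix}g_{N_b}\\0\end{bmatrix}$ if $N_a>N_b$, and $X_{ab}^T=X_{ba}$. Theorem. Let $I\subseteq\mathbb R$ be an open interval (for example $I=\mathbb R$) and let $g$ be a real matrix function of order $m+2n$ on $I$. Then $g$ has symmetric values and satisfies $\dfrac{dg}{d\xi}=Jg$ on $I$ if and only if, for some choice of the real constants (separate constants for each $\lambda_i$ and each $\Lambda_k$), one has on $I$ $$g=\operatorname{diag}\bigl(g_{m^1}(\lambda_1),\dots,g_{m^p}(\lambda_p),g_{n^1}(\Lambda_1),\dots,g_{n^q}(\Lambda_q)\bigr).$$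 In particular every symmetric solution is block diagonal of this form, and the constants are free. -/

import Mathlib

noncomputable section

namespace JordanFlow

/-! ### Generalized real Jordan matrices -/

/-- The Jordan cell `J_n(lam)`: `lam` on the diagonal, `1` on the superdiagonal. -/
def jordanCell (n : ℕ) (lam : ℝ) : Matrix (Fin n) (Fin n) ℝ :=
  Matrix.of fun a b =>
    if a = b then lam else if (a : ℕ) + 1 = (b : ℕ) then 1 else 0

/-- The matrix `Λ = [α, -β; β, α]` representing the conjugate pair `α ± i β`. -/
def Lam (α β : ℝ) : Matrix (Fin 2) (Fin 2) ℝ :=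
  !![α, -β; β, α]

/-- The Jordan `Λ`-block of the first kind `J_n(Λ)`: the `n × n` block matrix of `2 × 2` blocks
with `Λ` on the block diagonal and `I₂` on the block superdiagonal. The row index `(a, u)` is
row `u` inside the block row `a`. -/
def jordanLamCell (n : ℕ) (L : Matrix (Fin 2) (Fin 2) ℝ) :
    Matrix (Fin n × Fin 2) (Fin n × Fin 2) ℝ :=
  Matrix.of fun x y =>
    if x.1 = y.1 then L x.2 y.2
    else if (x.1 : ℕ) + 1 = (y.1 : ℕ) then (1 : Matrix (Fin 2) (Fin 2) ℝ) x.2 y.2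
    else 0

/-- The Jordan matrix `J_{n_1,…,n_r}(lam) = diag(J_{n_1}(lam), …, J_{n_r}(lam))`. -/
def jordanMatrix {r : ℕ} (n : Fin r → ℕ) (lam : ℝ) :
    Matrix (Σ a : Fin r, Fin (n a)) (Σ a : Fin r, Fin (n a)) ℝ :=
  Matrix.blockDiagonal' fun a => jordanCell (n a) lam

/-- The Jordan `Λ`-block of the second kind
`J_{n_1,…,n_s}(Λ) = diag(J_{n_1}(Λ), …, J_{n_s}(Λ))`. -/
def jordanLamMatrix {s : ℕ} (n : Fin s → ℕ) (L : Matrix (Fin 2) (Fin 2) ℝ) :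
    Matrix (Σ a : Fin s, Fin (n a) × Fin 2) (Σ a : Fin s, Fin (n a) × Fin 2) ℝ :=
  Matrix.blockDiagonal' fun a => jordanLamCell (n a) L

/-- Row and column index set of the generalized Jordan matrix: its cardinality is
`∑ i a, m i a + 2 * ∑ k b, n k b`. -/
abbrev Idx {p q : ℕ} {r : Fin p → ℕ} {s : Fin q → ℕ}
    (m : (i : Fin p) → Fin (r i) → ℕ) (n : (k : Fin q) → Fin (s k) → ℕ) : Type :=
  (Σ i : Fin p, Σ a : Fin (r i), Fin (m i a)) ⊕
    (Σ k : Fin q, Σ b : Fin (s k), Fin (n k b) × Fin 2)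

/-- `diag(A_1, …, A_p, B_1, …, B_q)`. -/
def diagBlocks {p q : ℕ} {r : Fin p → ℕ} {s : Fin q → ℕ}
    {m : (i : Fin p) → Fin (r i) → ℕ} {n : (k : Fin q) → Fin (s k) → ℕ}
    (A : (i : Fin p) →
      Matrix (Σ a : Fin (r i), Fin (m i a)) (Σ a : Fin (r i), Fin (m i a)) ℝ)
    (B : (k : Fin q) →
      Matrix (Σ b : Fin (s k), Fin (n k b) × Fin 2) (Σ b : Fin (s k), Fin (n k b) × Fin 2) ℝ) :
    Matrix (Idx m n) (Idx m n) ℝ :=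
  Matrix.fromBlocks (Matrix.blockDiagonal' A) 0 0 (Matrix.blockDiagonal' B)

/-- The generalized Jordan matrix
`diag(J_{m^1}(lam_1), …, J_{m^p}(lam_p), J_{n^1}(Λ_1), …, J_{n^q}(Λ_q))`. -/
def generalizedJordan {p q : ℕ} {r : Fin p → ℕ} {s : Fin q → ℕ}
    (m : (i : Fin p) → Fin (r i) → ℕ) (n : (k : Fin q) → Fin (s k) → ℕ)
    (lam : Fin p → ℝ) (α β : Fin q → ℝ) : Matrix (Idx m n) (Idx m n) ℝ :=
  diagBlocks (fun i => jordanMatrix (m i) (lam i))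
    (fun k => jordanLamMatrix (n k) (Lam (α k) (β k)))

/-- Entrywise derivative of a matrix function of one real variable. -/
def HasMatrixDerivAt {ι κ : Type} (g : ℝ → Matrix ι κ ℝ) (g' : Matrix ι κ ℝ) (ξ : ℝ) : Prop :=
  ∀ i j, HasDerivAt (fun t => g t i j) (g' i j) ξ

/-! ### The explicit blocks

Indices start at `0`: the constants are `C 0, …, C (n - 1)`, values of `C` beyond
`n - 1` are never used. -/

/-- `∑_{j=0}^{n-1-l} ξ^j / j! * C_{l+j}`, for `0 ≤ l < n`. -/
def polyPart (n : ℕ) (C : ℕ → ℝ) (l : ℕ) (ξ : ℝ) : ℝ :=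
  ∑ j ∈ Finset.range (n - l), ξ ^ j / (Nat.factorial j : ℝ) * C (l + j)

/-- `X_l(ξ) = e^{lam ξ} ∑_j ξ^j / j! * C_{l+j}`. -/
def realX (n : ℕ) (lam : ℝ) (C : ℕ → ℝ) (l : ℕ) (ξ : ℝ) : ℝ :=
  Real.exp (lam * ξ) * polyPart n C l ξ

/-- `g_n(lam)`: entry `X_{a+b}` on and above the main antidiagonal, `0` below it. -/
def gCell (n : ℕ) (lam : ℝ) (C : ℕ → ℝ) (ξ : ℝ) : Matrix (Fin n) (Fin n) ℝ :=
  Matrix.of fun a b =>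
    if (a : ℕ) + (b : ℕ) < n then realX n lam C ((a : ℕ) + (b : ℕ)) ξ else 0

/-- `X_l(ξ) = e^{α ξ} cos(β ξ) ∑_j ξ^j / j! * C_{l+j} - e^{α ξ} sin(β ξ) ∑_j ξ^j / j! * D_{l+j}`. -/
def lamX (n : ℕ) (α β : ℝ) (C D : ℕ → ℝ) (l : ℕ) (ξ : ℝ) : ℝ :=
  Real.exp (α * ξ) * Real.cos (β * ξ) * polyPart n C l ξ
    - Real.exp (α * ξ) * Real.sin (β * ξ) * polyPart n D l ξ

/-- `Y_l(ξ) = e^{α ξ} cos(β ξ) ∑_j ξ^j / j! * D_{l+j} + e^{α ξ} sin(β ξ) ∑_j ξ^j / j! * C_{l+j}`. -/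
def lamY (n : ℕ) (α β : ℝ) (C D : ℕ → ℝ) (l : ℕ) (ξ : ℝ) : ℝ :=
  Real.exp (α * ξ) * Real.cos (β * ξ) * polyPart n D l ξ
    + Real.exp (α * ξ) * Real.sin (β * ξ) * polyPart n C l ξ

/-- `Z_l = [X_l, Y_l; Y_l, -X_l]`. -/
def lamZ (n : ℕ) (α β : ℝ) (C D : ℕ → ℝ) (l : ℕ) (ξ : ℝ) : Matrix (Fin 2) (Fin 2) ℝ :=
  !![lamX n α β C D l ξ, lamY n α β C D l ξ;
     lamY n α β C D l ξ, -lamX n α β C D l ξ]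

/-- `g_n(Λ)`: block `Z_{a+b}` on and above the main block antidiagonal, `0` below it. -/
def gLamCell (n : ℕ) (α β : ℝ) (C D : ℕ → ℝ) (ξ : ℝ) :
    Matrix (Fin n × Fin 2) (Fin n × Fin 2) ℝ :=
  Matrix.of fun x y =>
    if (x.1 : ℕ) + (y.1 : ℕ) < n then lamZ n α β C D ((x.1 : ℕ) + (y.1 : ℕ)) ξ x.2 y.2 else 0

/-- The `n₁ × n₂` matrix with the `k × k` matrix `M` in its upper left corner, `0` elsewhere.
For `k = min n₁ n₂` it is `M` if `n₁ = n₂`, the row `[M 0]` if `n₁ < n₂`, and the column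
`[M; 0]` if `n₁ > n₂`. -/
def corner {k : ℕ} (n₁ n₂ : ℕ) (M : Matrix (Fin k) (Fin k) ℝ) : Matrix (Fin n₁) (Fin n₂) ℝ :=
  Matrix.of fun a b =>
    if h : (a : ℕ) < k ∧ (b : ℕ) < k then M ⟨a, h.1⟩ ⟨b, h.2⟩ else 0

/-- The version of `corner` for matrices made of `2 × 2` blocks. -/
def lamCorner {k : ℕ} (n₁ n₂ : ℕ) (M : Matrix (Fin k × Fin 2) (Fin k × Fin 2) ℝ) :
    Matrix (Fin n₁ × Fin 2) (Fin n₂ × Fin 2) ℝ :=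
  Matrix.of fun x y =>
    if h : (x.1 : ℕ) < k ∧ (y.1 : ℕ) < k then M (⟨x.1, h.1⟩, x.2) (⟨y.1, h.2⟩, y.2) else 0

/-- `g_{n_1,…,n_r}(lam)`: the block matrix `(X_{ab})` whose block `X_{ab}` is
`g_{min(n_a, n_b)}(lam)` with constants `C a b`, padded by zeros to size `n_a × n_b`. -/
def gMatrix {r : ℕ} (n : Fin r → ℕ) (lam : ℝ) (C : Fin r → Fin r → ℕ → ℝ) (ξ : ℝ) :
    Matrix (Σ a : Fin r, Fin (n a)) (Σ a : Fin r, Fin (n a)) ℝ :=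
  Matrix.of fun x y =>
    corner (n x.1) (n y.1) (gCell (min (n x.1) (n y.1)) lam (C x.1 y.1) ξ) x.2 y.2

/-- `g_{n_1,…,n_s}(Λ)`: the block matrix `(X_{ab})` whose block `X_{ab}` is
`g_{min(n_a, n_b)}(Λ)` with constants `C a b`, `D a b`, padded by zeros to size
`2 n_a × 2 n_b`. -/
def gLamMatrix {s : ℕ} (n : Fin s → ℕ) (α β : ℝ) (C D : Fin s → Fin s → ℕ → ℝ) (ξ : ℝ) :
    Matrix (Σ a : Fin s, Fin (n a) × Fin 2) (Σ a : Fin s, Fin (n a) × Fin 2) ℝ :=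
  Matrix.of fun x y =>
    lamCorner (n x.1) (n y.1)
      (gLamCell (min (n x.1) (n y.1)) α β (C x.1 y.1) (D x.1 y.1) ξ) x.2 y.2

end JordanFlow

end

noncomputable section

namespace JordanFlow

open Matrix

/-! ### Jordan chains of row vectors -/

/-! The derivative of a symmetric matrix is symmetric, so a symmetric solution satisfies `J g = g
Jᵀ` as well as `g' = J g`. Over `ℂ` each Jordan cell carries a chain of row vectors `φ x` with `φ x
* J = μ φ x + φ (x + 1)`. Evaluating `J G = G Jᵀ` on two chains with eigenvalues `μ`, `ν` gives, for
`h x y = φ x * G * ψ y`, the recursion `(μ - ν) h x y = h x (y + 1) - h (x + 1) y`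
(`IsChain.pairing_sylvester`). If `μ ≠ ν`, the pairing vanishes (`IsChain.pairing_eq_zero`), which
gives block diagonality. If `μ = ν`, it depends only on `x + y` (`IsChain.pairing_hankel`) and is
zero once `x + y` reaches the shorter chain length: this is the padded Hankel shape.

The differential equation then reduces to `h_l' = μ h_l + h_{l+1}`. The factor `exp (-μ ξ)` removes
`μ` and leaves Taylor polynomials with common coefficients, whose real and imaginary parts are the
constants (`IsChain.exists_pairing_eq`).

A pair `α ± iβ` gives two conjugate chains. Orthogonality of the chain for `α + iβ` to the one for
`α - iβ` forces every `2 × 2` block into the form `[X, Y; Y, -X]`; pairing the `α + iβ` chains gives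
`2 (X + iY)`. Conversely, `J` acts on the rows of the explicit matrix by the same recursion, which
its entries satisfy as scalar equations. -/

/-- A chain of row vectors `φ 0, φ 1, …` with `φ x * J = μ φ x + φ (x + 1)`, vanishing from `N` on. -/
structure IsChain {ι : Type} [Fintype ι] (J : Matrix ι ι ℂ) (N : ℕ) (μ : ℂ) (φ : ℕ → ι → ℂ) :
    Prop where
  vecMul_eq : ∀ x, φ x ᵥ* J = μ • φ x + φ (x + 1)
  eq_zero : ∀ x, N ≤ x → φ x = 0

/-- The values `φ x * G * ψ y` of the bilinear form `G` on two sequences of vectors. -/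
def pairing {ι : Type} [Fintype ι] (φ ψ : ℕ → ι → ℂ) (G : Matrix ι ι ℂ) (x y : ℕ) : ℂ :=
  φ x ⬝ᵥ (G *ᵥ ψ y)

section Pairing

variable {ι : Type} [Fintype ι] {J G : Matrix ι ι ℂ} {N M : ℕ} {μ ν : ℂ} {φ ψ : ℕ → ι → ℂ}

theorem IsChain.pairing_mul_left (hφ : IsChain J N μ φ) (x y : ℕ) :
    pairing φ ψ (J * G) x y = μ * pairing φ ψ G x y + pairing φ ψ G (x + 1) y := by
  simp only [pairing]
  rw [← mulVec_mulVec, dotProduct_mulVec, hφ.vecMul_eq, add_dotProduct, smul_dotProduct,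
    smul_eq_mul]

theorem IsChain.pairing_mul_transpose (hψ : IsChain J M ν ψ) (x y : ℕ) :
    pairing φ ψ (G * Jᵀ) x y = ν * pairing φ ψ G x y + pairing φ ψ G x (y + 1) := by
  simp only [pairing]
  rw [← mulVec_mulVec, mulVec_transpose, hψ.vecMul_eq, mulVec_add, mulVec_smul, dotProduct_add,
    dotProduct_smul, smul_eq_mul]

theorem IsChain.pairing_eq_zero_left (hφ : IsChain J N μ φ) {x : ℕ} (h : N ≤ x) (y : ℕ) :
    pairing φ ψ G x y = 0 := by
  simp [pairing, hφ.eq_zero x h]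

theorem IsChain.pairing_eq_zero_right (hψ : IsChain J M ν ψ) (x : ℕ) {y : ℕ} (h : M ≤ y) :
    pairing φ ψ G x y = 0 := by
  simp [pairing, hψ.eq_zero y h]

/-- Both sides evaluate the same matrix `J * G = G * Jᵀ`, with `J` absorbed by the left chain or by
the right one. -/
theorem IsChain.pairing_sylvester (hφ : IsChain J N μ φ) (hψ : IsChain J M ν ψ)
    (hG : J * G = G * Jᵀ) (x y : ℕ) :
    μ * pairing φ ψ G x y + pairing φ ψ G (x + 1) y
      = ν * pairing φ ψ G x y + pairing φ ψ G x (y + 1) := by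
  rw [← hφ.pairing_mul_left, ← hψ.pairing_mul_transpose, hG]

/-- Chains with different eigenvalues are orthogonal for `G` when `J * G = G * Jᵀ`. -/
theorem IsChain.pairing_eq_zero (hφ : IsChain J N μ φ) (hψ : IsChain J M ν ψ)
    (hG : J * G = G * Jᵀ) (hμν : μ ≠ ν) (x y : ℕ) : pairing φ ψ G x y = 0 := by
  -- Descending induction on `x + y`: beyond `N + M` one of the two chains is already zero.
  suffices H : ∀ d x y, N + M ≤ x + y + d → pairing φ ψ G x y = 0 from H (N + M) x y (by omega)
  intro d
  induction d with
  | zero =>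
    intro x y h
    rcases le_or_gt N x with hx | hx
    · exact hφ.pairing_eq_zero_left hx y
    · exact hψ.pairing_eq_zero_right x (by omega)
  | succ d ih =>
    intro x y h
    have e := hφ.pairing_sylvester hψ hG x y
    rw [ih (x + 1) y (by omega), ih x (y + 1) (by omega), add_zero, add_zero] at e
    by_contra h0
    exact hμν (mul_right_cancel₀ h0 e)

/-- Two chains with the same eigenvalue pair to a Hankel array when `J * G = G * Jᵀ`. -/
theorem IsChain.pairing_hankel (hφ : IsChain J N μ φ) (hψ : IsChain J M μ ψ)
    (hG : J * G = G * Jᵀ) (x y : ℕ) : pairing φ ψ G x y = pairing φ ψ G (x + y) 0 := by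
  induction y generalizing x with
  | zero => rfl
  | succ y ih =>
    rw [← add_left_cancel (hφ.pairing_sylvester hψ hG x y), ih (x + 1), add_right_comm, add_assoc]

/-- By the Hankel property the index `l` may be placed on either side, so the shorter chain decides.
-/
theorem IsChain.pairing_zero_right_eq_zero (hφ : IsChain J N μ φ) (hψ : IsChain J M μ ψ)
    (hG : J * G = G * Jᵀ) {l : ℕ} (h : min N M ≤ l) : pairing φ ψ G l 0 = 0 := by
  rcases min_le_iff.1 h with h | h
  · exact hφ.pairing_eq_zero_left h 0
  · rw [← zero_add l, ← hφ.pairing_hankel hψ hG]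
    exact hψ.pairing_eq_zero_right 0 h

end Pairing

/-! ### The scalar differential equations -/

theorem polyPart_eq_zero {n l : ℕ} (h : n ≤ l) (C : ℕ → ℝ) (ξ : ℝ) : polyPart n C l ξ = 0 := by
  simp [polyPart, Nat.sub_eq_zero_of_le h]

theorem realX_eq_zero {n l : ℕ} (h : n ≤ l) (lam : ℝ) (C : ℕ → ℝ) (ξ : ℝ) :
    realX n lam C l ξ = 0 := by
  simp [realX, polyPart_eq_zero h]

theorem lamX_eq_zero {n l : ℕ} (h : n ≤ l) (α β : ℝ) (C D : ℕ → ℝ) (ξ : ℝ) :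
    lamX n α β C D l ξ = 0 := by
  simp [lamX, polyPart_eq_zero h]

theorem lamY_eq_zero {n l : ℕ} (h : n ≤ l) (α β : ℝ) (C D : ℕ → ℝ) (ξ : ℝ) :
    lamY n α β C D l ξ = 0 := by
  simp [lamY, polyPart_eq_zero h]

theorem hasDerivAt_pow_div_factorial (j : ℕ) (ξ : ℝ) :
    HasDerivAt (fun t : ℝ => t ^ (j + 1) / (Nat.factorial (j + 1) : ℝ))
      (ξ ^ j / (Nat.factorial j : ℝ)) ξ := by
  have h := (hasDerivAt_pow (j + 1) ξ).div_const (Nat.factorial (j + 1) : ℝ)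
  refine h.congr_deriv ?_
  rw [Nat.factorial_succ]
  have := Nat.factorial_ne_zero j
  push_cast
  field_simp

/-- The truncation keeps `l + j < n`, so differentiation drops the `j = 0` term and shifts `l`
without changing the constants. -/
theorem hasDerivAt_polyPart (n : ℕ) (C : ℕ → ℝ) (l : ℕ) (ξ : ℝ) :
    HasDerivAt (polyPart n C l) (polyPart n C (l + 1) ξ) ξ := by
  rcases le_or_gt n l with h | h
  · have : polyPart n C l = fun _ => 0 := funext fun t => polyPart_eq_zero h C t
    rw [this, polyPart_eq_zero (by omega)]
    exact hasDerivAt_const ξ 0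
  · obtain ⟨d, rfl⟩ := Nat.exists_eq_add_of_lt h
    have e : polyPart (l + d + 1) C l = fun t => (∑ j ∈ Finset.range d,
        t ^ (j + 1) / (Nat.factorial (j + 1) : ℝ) * C (l + (j + 1))) + C l := by
      funext t
      rw [polyPart, show l + d + 1 - l = d + 1 by omega, Finset.sum_range_succ']
      simp
    rw [e, polyPart, show l + d + 1 - (l + 1) = d by omega]
    refine HasDerivAt.add_const _ (HasDerivAt.fun_sum fun j _ => ?_)
    rw [show l + 1 + j = l + (j + 1) by omega]
    exact (hasDerivAt_pow_div_factorial j ξ).mul_const _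

theorem hasDerivAt_exp_mul (a ξ : ℝ) :
    HasDerivAt (fun t => Real.exp (a * t)) (a * Real.exp (a * ξ)) ξ := by
  have h := ((hasDerivAt_id ξ).const_mul a).exp
  simpa [mul_comm] using h

theorem hasDerivAt_realX (n : ℕ) (lam : ℝ) (C : ℕ → ℝ) (l : ℕ) (ξ : ℝ) :
    HasDerivAt (realX n lam C l) (lam * realX n lam C l ξ + realX n lam C (l + 1) ξ) ξ := by
  have h := (hasDerivAt_exp_mul lam ξ).mul (hasDerivAt_polyPart n C l ξ)
  refine h.congr_deriv ?_
  simp only [realX]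
  ring

theorem hasDerivAt_cos_mul (b ξ : ℝ) :
    HasDerivAt (fun t => Real.cos (b * t)) (-(b * Real.sin (b * ξ))) ξ := by
  have h := ((hasDerivAt_id ξ).const_mul b).cos
  simpa [mul_comm] using h

theorem hasDerivAt_sin_mul (b ξ : ℝ) :
    HasDerivAt (fun t => Real.sin (b * t)) (b * Real.cos (b * ξ)) ξ := by
  have h := ((hasDerivAt_id ξ).const_mul b).sin
  simpa [mul_comm] using h

/-- Real part of `h_l' = (α + iβ) h_l + h_{l+1}` for `h_l = X_l + i Y_l`; the next lemma is the
imaginary part. -/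
theorem hasDerivAt_lamX (n : ℕ) (α β : ℝ) (C D : ℕ → ℝ) (l : ℕ) (ξ : ℝ) :
    HasDerivAt (lamX n α β C D l)
      (α * lamX n α β C D l ξ - β * lamY n α β C D l ξ + lamX n α β C D (l + 1) ξ) ξ := by
  have hc := (hasDerivAt_exp_mul α ξ).mul (hasDerivAt_cos_mul β ξ)
  have hs := (hasDerivAt_exp_mul α ξ).mul (hasDerivAt_sin_mul β ξ)
  have h := (hc.mul (hasDerivAt_polyPart n C l ξ)).sub (hs.mul (hasDerivAt_polyPart n D l ξ))
  refine h.congr_deriv ?_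
  simp only [lamX, lamY, Pi.mul_apply]
  ring

theorem hasDerivAt_lamY (n : ℕ) (α β : ℝ) (C D : ℕ → ℝ) (l : ℕ) (ξ : ℝ) :
    HasDerivAt (lamY n α β C D l)
      (β * lamX n α β C D l ξ + α * lamY n α β C D l ξ + lamY n α β C D (l + 1) ξ) ξ := by
  have hc := (hasDerivAt_exp_mul α ξ).mul (hasDerivAt_cos_mul β ξ)
  have hs := (hasDerivAt_exp_mul α ξ).mul (hasDerivAt_sin_mul β ξ)
  have h := (hc.mul (hasDerivAt_polyPart n D l ξ)).add (hs.mul (hasDerivAt_polyPart n C l ξ))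
  refine h.congr_deriv ?_
  simp only [lamX, lamY, Pi.mul_apply]
  ring

/-- A finite sequence of functions, each the derivative of the preceding one and the last one
constant, consists of Taylor polynomials with common coefficients. -/
theorem exists_eq_taylor_of_hasDerivAt_succ {I : Set ℝ} (hIo : IsOpen I) (hIc : IsPreconnected I)
    (k : ℕ) (u : ℕ → ℝ → ℂ) (hd : ∀ l, ∀ ξ ∈ I, HasDerivAt (u l) (u (l + 1) ξ) ξ)
    (hz : ∀ l, k ≤ l → ∀ ξ ∈ I, u l ξ = 0) :
    ∃ c : ℕ → ℂ, ∀ l, ∀ ξ ∈ I, u l ξ =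
      ∑ j ∈ Finset.range (k - l), ((ξ ^ j / (Nat.factorial j : ℝ) : ℝ) : ℂ) * c (l + j) := by
  induction k generalizing u with
  | zero => exact ⟨0, fun l ξ hξ => by simpa using hz l (Nat.zero_le l) ξ hξ⟩
  | succ k ih =>
    obtain ⟨c, hc⟩ := ih (fun l => u (l + 1)) (fun l => hd (l + 1))
      (fun l hl => hz (l + 1) (by omega))
    -- The shifted sequence supplies `c`; integrating its first polynomial recovers `u 0` up to a
    -- constant `c₀`, which becomes the new leading coefficient.
    have hP : ∀ ξ ∈ I, HasDerivAt (fun t : ℝ => u 0 t - ∑ j ∈ Finset.range k,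
        ((t ^ (j + 1) / (Nat.factorial (j + 1) : ℝ) : ℝ) : ℂ) * c j) 0 ξ := by
      intro ξ hξ
      have h := (hd 0 ξ hξ).fun_sub (HasDerivAt.fun_sum (u := Finset.range k)
        fun j _ => ((hasDerivAt_pow_div_factorial j ξ).ofReal_comp.mul_const (c j)))
      refine h.congr_deriv ?_
      rw [hc 0 ξ hξ]
      simp
    obtain ⟨c₀, hc₀⟩ := hIo.exists_is_const_of_deriv_eq_zero hIc
      (fun ξ hξ => (hP ξ hξ).differentiableAt.differentiableWithinAt)
      (fun ξ hξ => (hP ξ hξ).deriv)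
    refine ⟨fun j => Nat.casesOn j c₀ c, fun l ξ hξ => ?_⟩
    cases l with
    | zero =>
      rw [Nat.sub_zero, Finset.sum_range_succ']
      simp only [zero_add, Nat.factorial_zero, pow_zero]
      rw [← hc₀ ξ hξ]
      simp
    | succ l =>
      rw [hc l ξ hξ, Nat.add_sub_add_right]
      refine Finset.sum_congr rfl fun j _ => ?_
      rw [show l + 1 + j = (l + j) + 1 by omega]

theorem lamX_add_lamY_mul_I (n : ℕ) (α β : ℝ) (c : ℕ → ℂ) (l : ℕ) (ξ : ℝ) :
    Complex.exp ((⟨α, β⟩ : ℂ) * ξ) * ∑ j ∈ Finset.range (n - l),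
        ((ξ ^ j / (Nat.factorial j : ℝ) : ℝ) : ℂ) * c (l + j)
      = ⟨lamX n α β (fun j => (c j).re) (fun j => (c j).im) l ξ,
          lamY n α β (fun j => (c j).re) (fun j => (c j).im) l ξ⟩ := by
  have hs : ∑ j ∈ Finset.range (n - l), ((ξ ^ j / (Nat.factorial j : ℝ) : ℝ) : ℂ) * c (l + j)
      = ⟨polyPart n (fun j => (c j).re) l ξ, polyPart n (fun j => (c j).im) l ξ⟩ := by
    apply Complex.ext <;> simp only [Complex.re_sum, Complex.im_sum, Complex.re_ofReal_mul,
      Complex.im_ofReal_mul, polyPart]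
  rw [hs]
  apply Complex.ext
  · simp [Complex.exp_re, Complex.exp_im, lamX]
  · simp [Complex.exp_re, Complex.exp_im, lamY]

/-- The general solution of `h_l' = (α + i β) h_l + h_{l+1}`, `h_l = 0` for `k ≤ l`. -/
theorem exists_eq_lamX_lamY {I : Set ℝ} (hIo : IsOpen I) (hIc : IsPreconnected I)
    (k : ℕ) (α β : ℝ) (h : ℕ → ℝ → ℂ)
    (hd : ∀ l, ∀ ξ ∈ I, HasDerivAt (h l) ((⟨α, β⟩ : ℂ) * h l ξ + h (l + 1) ξ) ξ)
    (hz : ∀ l, k ≤ l → ∀ ξ ∈ I, h l ξ = 0) :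
    ∃ C D : ℕ → ℝ, ∀ l, ∀ ξ ∈ I, h l ξ = ⟨lamX k α β C D l ξ, lamY k α β C D l ξ⟩ := by
  set μ : ℂ := ⟨α, β⟩ with hμ
  have he : ∀ ξ : ℝ, HasDerivAt (fun t : ℝ => Complex.exp (-μ * t))
      (-μ * Complex.exp (-μ * ξ)) ξ := by
    intro ξ
    have h := (((hasDerivAt_id ξ).ofReal_comp).const_mul (-μ)).cexp
    simpa [mul_comm] using h
  -- The integrating factor `exp (-μ t)` turns the recursion into plain successive derivatives.
  obtain ⟨c, hc⟩ := exists_eq_taylor_of_hasDerivAt_succ hIo hIc k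
    (fun l t => Complex.exp (-μ * t) * h l t)
    (fun l ξ hξ => by
      refine ((he ξ).fun_mul (hd l ξ hξ)).congr_deriv ?_
      ring)
    (fun l hl ξ hξ => by simp [hz l hl ξ hξ])
  refine ⟨fun j => (c j).re, fun j => (c j).im, fun l ξ hξ => ?_⟩
  rw [← lamX_add_lamY_mul_I, ← hc l ξ hξ, ← mul_assoc, ← hμ, ← Complex.exp_add]
  simp

/-- The pairing of two chains with the same eigenvalue along a solution of `G' = J G`
with `J G = G Jᵀ`. -/
theorem IsChain.exists_pairing_eq {ι : Type} [Fintype ι] {J : Matrix ι ι ℂ} {N M : ℕ} {α β : ℝ}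
    {φ ψ : ℕ → ι → ℂ} (hφ : IsChain J N ⟨α, β⟩ φ) (hψ : IsChain J M ⟨α, β⟩ ψ)
    {I : Set ℝ} (hIo : IsOpen I) (hIc : IsPreconnected I) (G : ℝ → Matrix ι ι ℂ)
    (hG : ∀ ξ ∈ I, J * G ξ = G ξ * Jᵀ)
    (hd : ∀ ξ ∈ I, ∀ i j, HasDerivAt (fun t => G t i j) ((J * G ξ) i j) ξ) :
    ∃ C D : ℕ → ℝ, ∀ x y, ∀ ξ ∈ I, pairing φ ψ (G ξ) x y =
      ⟨lamX (min N M) α β C D (x + y) ξ, lamY (min N M) α β C D (x + y) ξ⟩ := by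
  obtain ⟨C, D, h⟩ := exists_eq_lamX_lamY hIo hIc (min N M) α β
    (fun l ξ => pairing φ ψ (G ξ) l 0)
    (fun l ξ hξ => by
      rw [← hφ.pairing_mul_left]
      simp only [pairing, dotProduct, mulVec]
      exact HasDerivAt.fun_sum fun i _ => HasDerivAt.const_mul _
        (HasDerivAt.fun_sum fun j _ => (hd ξ hξ i j).mul_const _))
    (fun l hl ξ hξ => hφ.pairing_zero_right_eq_zero hψ (hG ξ hξ) hl)
  exact ⟨C, D, fun x y ξ hξ => by rw [hφ.pairing_hankel hψ (hG ξ hξ), h (x + y) ξ hξ]⟩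

/-! ### Entries of the explicit blocks -/

/-- Both kinds of zero, the padding and the part below the antidiagonal, occur at `x + y ≥ min (n a)
(n b)`, where `realX` vanishes as an empty sum. One formula thus covers all entries. -/
theorem gMatrix_apply {r : ℕ} (n : Fin r → ℕ) (lam : ℝ) (C : Fin r → Fin r → ℕ → ℝ) (ξ : ℝ)
    (a b : Fin r) (x : Fin (n a)) (y : Fin (n b)) :
    gMatrix n lam C ξ ⟨a, x⟩ ⟨b, y⟩
      = realX (min (n a) (n b)) lam (C a b) ((x : ℕ) + (y : ℕ)) ξ := by
  simp only [gMatrix, corner, gCell, Matrix.of_apply]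
  split_ifs with h h'
  · rfl
  · exact (realX_eq_zero (by omega) _ _ _).symm
  · exact (realX_eq_zero (by omega) _ _ _).symm

theorem lamZ_eq_zero {n l : ℕ} (h : n ≤ l) (α β : ℝ) (C D : ℕ → ℝ) (ξ : ℝ) :
    lamZ n α β C D l ξ = 0 := by
  ext u v
  fin_cases u <;> fin_cases v <;> simp [lamZ, lamX_eq_zero h, lamY_eq_zero h]

theorem lamZ_comm (n l : ℕ) (α β : ℝ) (C D : ℕ → ℝ) (ξ : ℝ) (u v : Fin 2) :
    lamZ n α β C D l ξ u v = lamZ n α β C D l ξ v u := by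
  fin_cases u <;> fin_cases v <;> rfl

theorem gLamMatrix_apply {s : ℕ} (n : Fin s → ℕ) (α β : ℝ) (C D : Fin s → Fin s → ℕ → ℝ) (ξ : ℝ)
    (a b : Fin s) (x : Fin (n a)) (y : Fin (n b)) (u v : Fin 2) :
    gLamMatrix n α β C D ξ ⟨a, x, u⟩ ⟨b, y, v⟩
      = lamZ (min (n a) (n b)) α β (C a b) (D a b) ((x : ℕ) + (y : ℕ)) ξ u v := by
  simp only [gLamMatrix, lamCorner, gLamCell, Matrix.of_apply]
  split_ifs with h h'
  · rfl
  · rw [lamZ_eq_zero (by omega)]; rfl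
  · rw [lamZ_eq_zero (by omega)]; rfl

/-! ### The Jordan chains of the generalized Jordan matrix -/

section Chains

variable {p q : ℕ} {r : Fin p → ℕ} {s : Fin q → ℕ}
  (m : (i : Fin p) → Fin (r i) → ℕ) (n : (k : Fin q) → Fin (s k) → ℕ)

/-- The `x`-th basis row vector of the cell `a` of the eigenvalue `i`, zero beyond the cell. -/
def realVec (i : Fin p) (a : Fin (r i)) (x : ℕ) : Idx m n → ℝ :=
  if h : x < m i a then Pi.single (Sum.inl ⟨i, a, x, h⟩) 1 else 0

/-- The basis row vector at the place `u` of the `x`-th `2 × 2` block of the cell `b` of the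
eigenvalue pair `k`, zero beyond the cell. -/
def lamVec (k : Fin q) (b : Fin (s k)) (u : Fin 2) (x : ℕ) : Idx m n → ℝ :=
  if h : x < n k b then Pi.single (Sum.inr ⟨k, b, ⟨x, h⟩, u⟩) 1 else 0

variable {m n}

theorem realVec_of_lt (i : Fin p) (a : Fin (r i)) (x : Fin (m i a)) :
    realVec m n i a x = Pi.single (Sum.inl ⟨i, a, x⟩) 1 := by
  simp [realVec]

theorem realVec_of_le {i : Fin p} {a : Fin (r i)} {x : ℕ} (h : m i a ≤ x) :
    realVec m n i a x = 0 := by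
  simp [realVec, h]

theorem lamVec_of_lt (k : Fin q) (b : Fin (s k)) (u : Fin 2) (x : Fin (n k b)) :
    lamVec m n k b u x = Pi.single (Sum.inr ⟨k, b, x, u⟩) 1 := by
  simp [lamVec]

theorem lamVec_of_le {k : Fin q} {b : Fin (s k)} {u : Fin 2} {x : ℕ} (h : n k b ≤ x) :
    lamVec m n k b u x = 0 := by
  simp [lamVec, h]

theorem realVec_inl_self (i : Fin p) (a : Fin (r i)) (x : ℕ) (y : Fin (m i a)) :
    realVec m n i a x (Sum.inl ⟨i, a, y⟩) = if (y : ℕ) = x then 1 else 0 := by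
  unfold realVec
  split_ifs with h h' h'
  · subst h'; simp
  · rw [Pi.single_apply, if_neg]
    simp [Fin.ext_iff, h']
  · omega
  · rfl

theorem realVec_inl_of_ne_cell (i : Fin p) {a b : Fin (r i)} (hab : b ≠ a) (x : ℕ)
    (y : Fin (m i b)) : realVec m n i a x (Sum.inl ⟨i, b, y⟩) = 0 := by
  unfold realVec
  split_ifs <;> simp [hab]

theorem realVec_inl_of_ne {i j : Fin p} (hij : j ≠ i) (a : Fin (r i)) (x : ℕ)
    (w : Σ b : Fin (r j), Fin (m j b)) : realVec m n i a x (Sum.inl ⟨j, w⟩) = 0 := by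
  unfold realVec
  split_ifs <;> simp [hij]

theorem realVec_inr (i : Fin p) (a : Fin (r i)) (x : ℕ)
    (w : Σ k : Fin q, Σ b : Fin (s k), Fin (n k b) × Fin 2) :
    realVec m n i a x (Sum.inr w) = 0 := by
  unfold realVec
  split_ifs <;> simp

theorem lamVec_inr_self (k : Fin q) (b : Fin (s k)) (u v : Fin 2) (x : ℕ) (y : Fin (n k b)) :
    lamVec m n k b u x (Sum.inr ⟨k, b, y, v⟩) = if (y : ℕ) = x ∧ v = u then 1 else 0 := by
  unfold lamVec
  split_ifs with h h' h'
  · obtain ⟨rfl, rfl⟩ := h'; simp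
  · rw [Pi.single_apply, if_neg]
    simpa [Fin.ext_iff] using h'
  · omega
  · rfl

theorem lamVec_inr_of_ne_cell (k : Fin q) {b c : Fin (s k)} (hbc : c ≠ b) (u : Fin 2) (x : ℕ)
    (w : Fin (n k c) × Fin 2) : lamVec m n k b u x (Sum.inr ⟨k, c, w⟩) = 0 := by
  unfold lamVec
  split_ifs <;> simp [hbc]

theorem lamVec_inr_of_ne {k l : Fin q} (hkl : l ≠ k) (b : Fin (s k)) (u : Fin 2) (x : ℕ)
    (w : Σ c : Fin (s l), Fin (n l c) × Fin 2) :
    lamVec m n k b u x (Sum.inr ⟨l, w⟩) = 0 := by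
  unfold lamVec
  split_ifs <;> simp [hkl]

theorem lamVec_inl (k : Fin q) (b : Fin (s k)) (u : Fin 2) (x : ℕ)
    (w : Σ i : Fin p, Σ a : Fin (r i), Fin (m i a)) :
    lamVec m n k b u x (Sum.inl w) = 0 := by
  unfold lamVec
  split_ifs <;> simp

/-- Extension by zero beyond the cell accounts for the missing superdiagonal `1` in the last row. -/
theorem realVec_vecMul (lam : Fin p → ℝ) (α β : Fin q → ℝ) (i : Fin p) (a : Fin (r i)) (x : ℕ) :
    realVec m n i a x ᵥ* generalizedJordan m n lam α β
      = lam i • realVec m n i a x + realVec m n i a (x + 1) := by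
  rcases le_or_gt (m i a) x with h | h
  · simp [realVec_of_le h, realVec_of_le (h.trans (Nat.le_succ x))]
  lift x to Fin (m i a) using h
  rw [realVec_of_lt, single_one_vecMul, ← realVec_of_lt]
  funext v
  rcases v with ⟨j, b, y⟩ | w
  · by_cases hij : j = i
    · subst hij
      by_cases hab : b = a
      · subst hab
        simp only [generalizedJordan, diagBlocks, Matrix.row_apply, fromBlocks_apply₁₁,
          blockDiagonal'_apply_eq, jordanMatrix, jordanCell, Matrix.of_apply, Pi.add_apply,
          Pi.smul_apply, realVec_inl_self, Fin.ext_iff, smul_eq_mul]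
        split_ifs <;> first | omega | simp
      · simp [generalizedJordan, diagBlocks, jordanMatrix, realVec_inl_of_ne_cell _ hab,
          blockDiagonal'_apply_ne _ _ _ (Ne.symm hab)]
    · simp [generalizedJordan, diagBlocks, realVec_inl_of_ne hij,
        blockDiagonal'_apply_ne _ _ _ (Ne.symm hij)]
  · simp [generalizedJordan, diagBlocks, realVec_inr]

theorem lamVec_vecMul (lam : Fin p → ℝ) (α β : Fin q → ℝ) (k : Fin q) (b : Fin (s k))
    (u : Fin 2) (x : ℕ) :
    lamVec m n k b u x ᵥ* generalizedJordan m n lam α β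
      = Lam (α k) (β k) u 0 • lamVec m n k b 0 x + Lam (α k) (β k) u 1 • lamVec m n k b 1 x
        + lamVec m n k b u (x + 1) := by
  rcases le_or_gt (n k b) x with h | h
  · simp [lamVec_of_le h, lamVec_of_le (h.trans (Nat.le_succ x))]
  lift x to Fin (n k b) using h
  rw [lamVec_of_lt k b u, single_one_vecMul]
  funext v
  rcases v with w | ⟨l, c, y, v⟩
  · simp [generalizedJordan, diagBlocks, lamVec_inl]
  · by_cases hkl : l = k
    · subst hkl
      by_cases hbc : c = b
      · subst hbc
        simp only [generalizedJordan, diagBlocks, Matrix.row_apply, fromBlocks_apply₂₂,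
          blockDiagonal'_apply_eq, jordanLamMatrix, jordanLamCell, Matrix.of_apply, Pi.add_apply,
          Pi.smul_apply, lamVec_inr_self, Fin.ext_iff, smul_eq_mul]
        rcases eq_or_ne (y : ℕ) x with hyx | hyx
        · rw [if_pos hyx.symm]
          fin_cases v <;> simp [hyx]
        · rw [if_neg hyx.symm]
          simp only [hyx, false_and, if_false, mul_zero, zero_add, Matrix.one_apply, Fin.ext_iff]
          split_ifs <;> first | omega | rfl
      · simp [generalizedJordan, diagBlocks, jordanLamMatrix, lamVec_inr_of_ne_cell _ hbc,
          blockDiagonal'_apply_ne _ _ _ (Ne.symm hbc)]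
    · simp [generalizedJordan, diagBlocks, lamVec_inr_of_ne hkl,
        blockDiagonal'_apply_ne _ _ _ (Ne.symm hkl)]

/-! ### The explicit matrix solves the differential equation -/

section Explicit

variable (lam : Fin p → ℝ) (α β : Fin q → ℝ)
  (B : (i : Fin p) → Fin (r i) → Fin (r i) → ℕ → ℝ)
  (C D : (k : Fin q) → Fin (s k) → Fin (s k) → ℕ → ℝ)

/-- `diag(g_{m^1}(lam_1), …, g_{m^p}(lam_p), g_{n^1}(Λ_1), …, g_{n^q}(Λ_q))`. -/
def explicitSolution (ξ : ℝ) : Matrix (Idx m n) (Idx m n) ℝ :=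
  diagBlocks (fun i => gMatrix (m i) (lam i) (B i) ξ)
    (fun k => gLamMatrix (n k) (α k) (β k) (C k) (D k) ξ)

theorem explicitSolution_inl_inl_self (ξ : ℝ) (i : Fin p) (a b : Fin (r i))
    (x : Fin (m i a)) (y : Fin (m i b)) :
    explicitSolution (m := m) (n := n) lam α β B C D ξ (Sum.inl ⟨i, a, x⟩) (Sum.inl ⟨i, b, y⟩)
      = realX (min (m i a) (m i b)) (lam i) (B i a b) ((x : ℕ) + (y : ℕ)) ξ := by
  simp only [explicitSolution, diagBlocks, fromBlocks_apply₁₁, blockDiagonal'_apply_eq,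
    gMatrix_apply]

theorem explicitSolution_inl_inl_of_ne (ξ : ℝ) {i j : Fin p} (hij : i ≠ j)
    (v : Σ a : Fin (r i), Fin (m i a)) (w : Σ a : Fin (r j), Fin (m j a)) :
    explicitSolution (m := m) (n := n) lam α β B C D ξ (Sum.inl ⟨i, v⟩) (Sum.inl ⟨j, w⟩) = 0 := by
  simp only [explicitSolution, diagBlocks, fromBlocks_apply₁₁, blockDiagonal'_apply_ne _ _ _ hij]

theorem explicitSolution_inl_inr (ξ : ℝ) (v : Σ i : Fin p, Σ a : Fin (r i), Fin (m i a))
    (w : Σ k : Fin q, Σ b : Fin (s k), Fin (n k b) × Fin 2) :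
    explicitSolution lam α β B C D ξ (Sum.inl v) (Sum.inr w) = 0 := by
  simp only [explicitSolution, diagBlocks, fromBlocks_apply₁₂, Matrix.zero_apply]

theorem explicitSolution_inr_inl (ξ : ℝ) (v : Σ k : Fin q, Σ b : Fin (s k), Fin (n k b) × Fin 2)
    (w : Σ i : Fin p, Σ a : Fin (r i), Fin (m i a)) :
    explicitSolution lam α β B C D ξ (Sum.inr v) (Sum.inl w) = 0 := by
  simp only [explicitSolution, diagBlocks, fromBlocks_apply₂₁, Matrix.zero_apply]

theorem explicitSolution_inr_inr_self (ξ : ℝ) (k : Fin q) (a b : Fin (s k))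
    (x : Fin (n k a)) (y : Fin (n k b)) (u v : Fin 2) :
    explicitSolution (m := m) (n := n) lam α β B C D ξ
        (Sum.inr ⟨k, a, x, u⟩) (Sum.inr ⟨k, b, y, v⟩)
      = lamZ (min (n k a) (n k b)) (α k) (β k) (C k a b) (D k a b) ((x : ℕ) + (y : ℕ)) ξ u v := by
  simp only [explicitSolution, diagBlocks, fromBlocks_apply₂₂, blockDiagonal'_apply_eq,
    gLamMatrix_apply]

theorem explicitSolution_inr_inr_of_ne (ξ : ℝ) {k l : Fin q} (hkl : k ≠ l)
    (v : Σ b : Fin (s k), Fin (n k b) × Fin 2) (w : Σ b : Fin (s l), Fin (n l b) × Fin 2) :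
    explicitSolution (m := m) (n := n) lam α β B C D ξ (Sum.inr ⟨k, v⟩) (Sum.inr ⟨l, w⟩) = 0 := by
  simp only [explicitSolution, diagBlocks, fromBlocks_apply₂₂, blockDiagonal'_apply_ne _ _ _ hkl]

theorem explicitSolution_isSymm (hB : ∀ i a b, B i a b = B i b a)
    (hC : ∀ k a b, C k a b = C k b a) (hD : ∀ k a b, D k a b = D k b a) (ξ : ℝ) :
    (explicitSolution (m := m) (n := n) lam α β B C D ξ).IsSymm := by
  refine Matrix.IsSymm.ext fun v w => ?_
  rcases v with ⟨i, a, x⟩ | ⟨k, a, x, u⟩ <;> rcases w with ⟨j, b, y⟩ | ⟨l, b, y, w⟩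
  · by_cases hij : i = j
    · subst hij
      rw [explicitSolution_inl_inl_self, explicitSolution_inl_inl_self, min_comm, hB i b a,
        add_comm]
    · rw [explicitSolution_inl_inl_of_ne _ _ _ _ _ _ _ hij,
        explicitSolution_inl_inl_of_ne _ _ _ _ _ _ _ (Ne.symm hij)]
  · rw [explicitSolution_inl_inr, explicitSolution_inr_inl]
  · rw [explicitSolution_inl_inr, explicitSolution_inr_inl]
  · by_cases hkl : k = l
    · subst hkl
      rw [explicitSolution_inr_inr_self, explicitSolution_inr_inr_self, min_comm, hC k b a,
        hD k b a, add_comm, lamZ_comm]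
    · rw [explicitSolution_inr_inr_of_ne _ _ _ _ _ _ _ hkl,
        explicitSolution_inr_inr_of_ne _ _ _ _ _ _ _ (Ne.symm hkl)]

theorem realVec_vecMul_explicitSolution_self (ξ : ℝ) (i : Fin p) (a b : Fin (r i)) (x : ℕ)
    (y : Fin (m i b)) :
    (realVec m n i a x ᵥ* explicitSolution lam α β B C D ξ) (Sum.inl ⟨i, b, y⟩)
      = realX (min (m i a) (m i b)) (lam i) (B i a b) (x + (y : ℕ)) ξ := by
  rcases le_or_gt (m i a) x with h | h
  · rw [realVec_of_le h, zero_vecMul, realX_eq_zero (by omega)]; rfl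
  · lift x to Fin (m i a) using h
    rw [realVec_of_lt, single_one_vecMul, Matrix.row_apply, explicitSolution_inl_inl_self]

theorem lamVec_vecMul_explicitSolution_self (ξ : ℝ) (k : Fin q) (a b : Fin (s k)) (u v : Fin 2)
    (x : ℕ) (y : Fin (n k b)) :
    (lamVec m n k a u x ᵥ* explicitSolution lam α β B C D ξ) (Sum.inr ⟨k, b, y, v⟩)
      = lamZ (min (n k a) (n k b)) (α k) (β k) (C k a b) (D k a b) (x + (y : ℕ)) ξ u v := by
  rcases le_or_gt (n k a) x with h | h
  · rw [lamVec_of_le h, zero_vecMul, lamZ_eq_zero (by omega)]; rfl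
  · lift x to Fin (n k a) using h
    rw [lamVec_of_lt, single_one_vecMul, Matrix.row_apply, explicitSolution_inr_inr_self]

/-- Under `ℝ² = ℂ`, `Λ` is multiplication by `α + iβ` and the columns of `Z_l` are `h_l` and `-i
h_l` with `h_l = X_l + i Y_l`. -/
theorem hasDerivAt_lamZ (N l : ℕ) (a b : ℝ) (c d : ℕ → ℝ) (ξ : ℝ) (u v : Fin 2) :
    HasDerivAt (fun t => lamZ N a b c d l t u v)
      (Lam a b u 0 * lamZ N a b c d l ξ 0 v + Lam a b u 1 * lamZ N a b c d l ξ 1 v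
        + lamZ N a b c d (l + 1) ξ u v) ξ := by
  have hX := hasDerivAt_lamX N a b c d l ξ
  have hY := hasDerivAt_lamY N a b c d l ξ
  fin_cases u <;> fin_cases v
  · exact hX.congr_deriv (by simp [Lam, lamZ]; ring)
  · exact hY.congr_deriv (by simp [Lam, lamZ]; ring)
  · exact hY.congr_deriv (by simp [Lam, lamZ])
  · exact hX.neg.congr_deriv (by simp [Lam, lamZ]; ring)

theorem hasMatrixDerivAt_explicitSolution (ξ : ℝ) :
    HasMatrixDerivAt (explicitSolution (m := m) (n := n) lam α β B C D)
      (generalizedJordan m n lam α β * explicitSolution lam α β B C D ξ) ξ := by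
  have row : ∀ (M : Matrix (Idx m n) (Idx m n) ℝ) v w, M v w = (Pi.single v 1 ᵥ* M) w := by
    intro M v w
    rw [single_one_vecMul, Matrix.row_apply]
  intro v w
  rcases v with ⟨i, a, x⟩ | ⟨k, a, x, u⟩
  · rw [row (_ * _), ← realVec_of_lt, ← vecMul_vecMul, realVec_vecMul, add_vecMul, smul_vecMul]
    rcases w with ⟨j, b, y⟩ | w
    · by_cases hij : i = j
      · subst hij
        simp only [Pi.add_apply, Pi.smul_apply, realVec_vecMul_explicitSolution_self,
          explicitSolution_inl_inl_self, smul_eq_mul]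
        rw [add_right_comm]
        exact hasDerivAt_realX _ _ _ _ _
      · have z : ∀ x', (realVec m n i a x' ᵥ* explicitSolution lam α β B C D ξ)
            (Sum.inl ⟨j, b, y⟩) = 0 := by
          intro x'
          unfold realVec
          split_ifs
          · rw [← row, explicitSolution_inl_inl_of_ne _ _ _ _ _ _ _ hij]
          · simp
        simp only [Pi.add_apply, Pi.smul_apply, z, smul_zero, add_zero,
          explicitSolution_inl_inl_of_ne _ _ _ _ _ _ _ hij]
        exact hasDerivAt_const _ _
    · have z : ∀ x', (realVec m n i a x' ᵥ* explicitSolution lam α β B C D ξ) (Sum.inr w) = 0 := by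
        intro x'
        unfold realVec
        split_ifs
        · rw [← row, explicitSolution_inl_inr]
        · simp
      simp only [Pi.add_apply, Pi.smul_apply, z, smul_zero, add_zero, explicitSolution_inl_inr]
      exact hasDerivAt_const _ _
  · rw [row (_ * _), ← lamVec_of_lt, ← vecMul_vecMul, lamVec_vecMul, add_vecMul, add_vecMul,
      smul_vecMul, smul_vecMul]
    rcases w with w | ⟨l, b, y, v⟩
    · have z : ∀ u x', (lamVec m n k a u x' ᵥ* explicitSolution lam α β B C D ξ)
          (Sum.inl w) = 0 := by
        intro u x'
        unfold lamVec
        split_ifs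
        · rw [← row, explicitSolution_inr_inl]
        · simp
      simp only [Pi.add_apply, Pi.smul_apply, z, smul_zero, add_zero, explicitSolution_inr_inl]
      exact hasDerivAt_const _ _
    · by_cases hkl : k = l
      · subst hkl
        simp only [Pi.add_apply, Pi.smul_apply, lamVec_vecMul_explicitSolution_self,
          explicitSolution_inr_inr_self, smul_eq_mul]
        rw [add_right_comm (x : ℕ)]
        exact hasDerivAt_lamZ _ _ _ _ _ _ _ _ _
      · have z : ∀ u x', (lamVec m n k a u x' ᵥ* explicitSolution lam α β B C D ξ)
            (Sum.inr ⟨l, b, y, v⟩) = 0 := by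
          intro u x'
          unfold lamVec
          split_ifs
          · rw [← row, explicitSolution_inr_inr_of_ne _ _ _ _ _ _ _ hkl]
          · simp
        simp only [Pi.add_apply, Pi.smul_apply, z, smul_zero, add_zero,
          explicitSolution_inr_inr_of_ne _ _ _ _ _ _ _ hkl]
        exact hasDerivAt_const _ _

end Explicit

end Chains

/-! ### Symmetric solutions -/

/-- A symmetric solution of `g' = J g` on an open set satisfies `J g = g Jᵀ` there. -/
theorem mul_eq_mul_transpose_of_hasMatrixDerivAt {ι : Type} [Fintype ι] {J : Matrix ι ι ℝ}
    {g : ℝ → Matrix ι ι ℝ} {I : Set ℝ} (hIo : IsOpen I)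
    (hg : ∀ ξ ∈ I, (g ξ).IsSymm ∧ HasMatrixDerivAt g (J * g ξ) ξ) {ξ : ℝ} (hξ : ξ ∈ I) :
    J * g ξ = g ξ * Jᵀ := by
  have hs : (J * g ξ)ᵀ = J * g ξ := by
    ext i j
    -- Entries `(i, j)` and `(j, i)` agree on a neighbourhood of `ξ`, so their derivatives coincide.
    refine ((hg ξ hξ).2 j i).unique (((hg ξ hξ).2 i j).congr_of_eventuallyEq ?_)
    filter_upwards [hIo.mem_nhds hξ] with t ht
    exact (hg t ht).1.apply i j
  rw [← hs, transpose_mul, (hg ξ hξ).1.eq]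

/-! ### Complexification of real vectors and matrices -/

section Cast

variable {ι : Type}

/-- The complexification of a real vector. -/
def castVec (u : ι → ℝ) : ι → ℂ := fun i => (u i : ℂ)

/-- The complexification of a real matrix. -/
abbrev castMat (g : Matrix ι ι ℝ) : Matrix ι ι ℂ := g.map Complex.ofRealHom

theorem castVec_zero : castVec (0 : ι → ℝ) = 0 := by
  funext i; simp [castVec]

theorem castVec_add (u v : ι → ℝ) : castVec (u + v) = castVec u + castVec v := by
  funext i; simp [castVec]

theorem castVec_smul (c : ℝ) (u : ι → ℝ) : castVec (c • u) = (c : ℂ) • castVec u := by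
  funext i; simp [castVec]

variable [Fintype ι]

theorem castVec_vecMul (u : ι → ℝ) (g : Matrix ι ι ℝ) :
    castVec u ᵥ* castMat g = castVec (u ᵥ* g) := by
  funext j
  exact (RingHom.map_vecMul Complex.ofRealHom g u j).symm

theorem castVec_dotProduct_mulVec (u v : ι → ℝ) (g : Matrix ι ι ℝ) :
    castVec u ⬝ᵥ (castMat g *ᵥ castVec v) = ((u ⬝ᵥ (g *ᵥ v) : ℝ) : ℂ) := by
  simp [dotProduct, mulVec, castVec]

theorem castMat_mul (g h : Matrix ι ι ℝ) : castMat (g * h) = castMat g * castMat h :=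
  Matrix.map_mul

end Cast

/-! ### Complex chains of the generalized Jordan matrix -/

section Forward

variable {p q : ℕ} {r : Fin p → ℕ} {s : Fin q → ℕ}
  (m : (i : Fin p) → Fin (r i) → ℕ) (n : (k : Fin q) → Fin (s k) → ℕ)

/-- The chain of the cell `a` of the real eigenvalue `i`. -/
def realChain (i : Fin p) (a : Fin (r i)) (x : ℕ) : Idx m n → ℂ :=
  castVec (realVec m n i a x)

/-- The chain of the cell `b` of the eigenvalue pair `k`; here `e` is one of `i` and `-i`. -/
def lamChain (e : ℂ) (k : Fin q) (b : Fin (s k)) (x : ℕ) : Idx m n → ℂ :=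
  castVec (lamVec m n k b 0 x) + e • castVec (lamVec m n k b 1 x)

variable {m n}

theorem isChain_realChain (lam : Fin p → ℝ) (α β : Fin q → ℝ) (i : Fin p) (a : Fin (r i)) :
    IsChain (castMat (generalizedJordan m n lam α β)) (m i a) (lam i) (realChain m n i a) where
  vecMul_eq x := by
    simp only [realChain, castVec_vecMul, realVec_vecMul, castVec_add, castVec_smul]
  eq_zero x h := by rw [realChain, realVec_of_le h, castVec_zero]

/-- The row `(1, e)` is a left eigenvector of `Λ` with eigenvalue `α + e β` exactly because `e * e =
-1`. -/
theorem isChain_lamChain (lam : Fin p → ℝ) (α β : Fin q → ℝ) {e : ℂ} (he : e * e = -1)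
    (k : Fin q) (b : Fin (s k)) :
    IsChain (castMat (generalizedJordan m n lam α β)) (n k b) (α k + e * β k)
      (lamChain m n e k b) where
  vecMul_eq x := by
    simp only [lamChain, add_vecMul, smul_vecMul, castVec_vecMul, lamVec_vecMul, castVec_add,
      castVec_smul]
    funext v
    simp only [Pi.add_apply, Pi.smul_apply, smul_eq_mul, Lam, of_apply, cons_val', cons_val_zero,
      cons_val_one, cons_val_fin_one, Complex.ofReal_neg]
    linear_combination (-(β k : ℂ) * castVec (lamVec m n k b 1 x) v) * he
  eq_zero x h := by
    rw [lamChain, lamVec_of_le h, lamVec_of_le h, castVec_zero, smul_zero, add_zero]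

theorem pairing_realChain_realChain (g : Matrix (Idx m n) (Idx m n) ℝ) (i j : Fin p)
    (a : Fin (r i)) (b : Fin (r j)) (x : Fin (m i a)) (y : Fin (m j b)) :
    pairing (realChain m n i a) (realChain m n j b) (castMat g) x y
      = g (Sum.inl ⟨i, a, x⟩) (Sum.inl ⟨j, b, y⟩) := by
  simp only [pairing, realChain]
  rw [castVec_dotProduct_mulVec, realVec_of_lt, realVec_of_lt, mulVec_single_one,
    single_one_dotProduct, Matrix.col_apply]

theorem pairing_realChain_lamChain (g : Matrix (Idx m n) (Idx m n) ℝ) (e : ℂ) (i : Fin p)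
    (k : Fin q) (a : Fin (r i)) (b : Fin (s k)) (x : Fin (m i a)) (y : Fin (n k b)) :
    pairing (realChain m n i a) (lamChain m n e k b) (castMat g) x y
      = g (Sum.inl ⟨i, a, x⟩) (Sum.inr ⟨k, b, y, 0⟩)
        + e * g (Sum.inl ⟨i, a, x⟩) (Sum.inr ⟨k, b, y, 1⟩) := by
  simp only [pairing, realChain, lamChain, mulVec_add, mulVec_smul, dotProduct_add,
    dotProduct_smul, castVec_dotProduct_mulVec, realVec_of_lt, lamVec_of_lt, mulVec_single_one,
    single_one_dotProduct, Matrix.col_apply, smul_eq_mul]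

theorem pairing_lamChain_lamChain (g : Matrix (Idx m n) (Idx m n) ℝ) (e f : ℂ) (k l : Fin q)
    (a : Fin (s k)) (b : Fin (s l)) (x : Fin (n k a)) (y : Fin (n l b)) :
    pairing (lamChain m n e k a) (lamChain m n f l b) (castMat g) x y
      = g (Sum.inr ⟨k, a, x, 0⟩) (Sum.inr ⟨l, b, y, 0⟩)
        + f * g (Sum.inr ⟨k, a, x, 0⟩) (Sum.inr ⟨l, b, y, 1⟩)
        + e * (g (Sum.inr ⟨k, a, x, 1⟩) (Sum.inr ⟨l, b, y, 0⟩)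
        + f * g (Sum.inr ⟨k, a, x, 1⟩) (Sum.inr ⟨l, b, y, 1⟩)) := by
  simp only [pairing, lamChain, mulVec_add, mulVec_smul, dotProduct_add, add_dotProduct,
    smul_dotProduct, dotProduct_smul, castVec_dotProduct_mulVec, lamVec_of_lt, mulVec_single_one,
    single_one_dotProduct, Matrix.col_apply, smul_eq_mul]
  ring

/-! ### Consequences of `J g = g Jᵀ` at a single point -/

section Algebraic

variable {lam : Fin p → ℝ} {α β : Fin q → ℝ} {g : Matrix (Idx m n) (Idx m n) ℝ}

theorem castMat_mul_eq (hg : generalizedJordan m n lam α β * g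
      = g * (generalizedJordan m n lam α β)ᵀ) :
    castMat (generalizedJordan m n lam α β) * castMat g
      = castMat g * (castMat (generalizedJordan m n lam α β))ᵀ := by
  rw [← castMat_mul, hg, castMat_mul]
  rfl

theorem apply_inl_inl_eq_zero (hlam : Function.Injective lam)
    (hg : generalizedJordan m n lam α β * g = g * (generalizedJordan m n lam α β)ᵀ)
    {i j : Fin p} (hij : i ≠ j) (a : Fin (r i)) (b : Fin (r j)) (x : Fin (m i a))
    (y : Fin (m j b)) : g (Sum.inl ⟨i, a, x⟩) (Sum.inl ⟨j, b, y⟩) = 0 := by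
  have h := (isChain_realChain lam α β i a).pairing_eq_zero (isChain_realChain lam α β j b)
    (castMat_mul_eq hg) (fun h => hij (hlam (Complex.ofReal_injective h))) x y
  rw [pairing_realChain_realChain] at h
  exact_mod_cast h

/-- A real eigenvalue differs from `α + iβ` as `β > 0`; the vanishing pairing has the two real
entries as its real and imaginary parts. -/
theorem apply_inl_inr_eq_zero (hβ : ∀ k, 0 < β k)
    (hg : generalizedJordan m n lam α β * g = g * (generalizedJordan m n lam α β)ᵀ)
    (i : Fin p) (k : Fin q) (a : Fin (r i)) (b : Fin (s k)) (x : Fin (m i a))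
    (y : Fin (n k b)) (u : Fin 2) : g (Sum.inl ⟨i, a, x⟩) (Sum.inr ⟨k, b, y, u⟩) = 0 := by
  have h := (isChain_realChain lam α β i a).pairing_eq_zero
    (isChain_lamChain lam α β Complex.I_mul_I k b)
    (castMat_mul_eq hg) (fun h => (hβ k).ne (by simpa using congrArg Complex.im h)) x y
  rw [pairing_realChain_lamChain] at h
  have h0 := congrArg Complex.re h
  have h1 := congrArg Complex.im h
  simp at h0 h1
  fin_cases u
  · exact h0
  · exact h1

/-- The chains of two conjugate eigenvalues pair to zero. -/
theorem apply_inr_inr_conj (hβ : ∀ k, 0 < β k)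
    (hg : generalizedJordan m n lam α β * g = g * (generalizedJordan m n lam α β)ᵀ)
    (k l : Fin q) (a : Fin (s k)) (b : Fin (s l)) (x : Fin (n k a)) (y : Fin (n l b)) :
    g (Sum.inr ⟨k, a, x, 1⟩) (Sum.inr ⟨l, b, y, 1⟩)
        = -g (Sum.inr ⟨k, a, x, 0⟩) (Sum.inr ⟨l, b, y, 0⟩) ∧
      g (Sum.inr ⟨k, a, x, 1⟩) (Sum.inr ⟨l, b, y, 0⟩)
        = g (Sum.inr ⟨k, a, x, 0⟩) (Sum.inr ⟨l, b, y, 1⟩) := by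
  have h := (isChain_lamChain lam α β Complex.I_mul_I k a).pairing_eq_zero
    (isChain_lamChain lam α β (e := -Complex.I) (by simp) l b) (castMat_mul_eq hg)
    -- The imaginary parts `β k > 0` and `-β l < 0` differ, even when `k = l`.
    (fun h => by
      have := congrArg Complex.im h
      simp at this
      linarith [hβ k, hβ l]) x y
  rw [pairing_lamChain_lamChain] at h
  have h0 := congrArg Complex.re h
  have h1 := congrArg Complex.im h
  simp at h0 h1
  constructor <;> linarith

/-- Orthogonality of the chains for `α + iβ` kills `g₀₀ - g₁₁` and `g₀₁ + g₁₀`; `apply_inr_inr_conj`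
kills `g₀₀ + g₁₁` and `g₁₀ - g₀₁`. -/
theorem apply_inr_inr_eq_zero (hβ : ∀ k, 0 < β k)
    (hLam : Function.Injective fun k => Lam (α k) (β k))
    (hg : generalizedJordan m n lam α β * g = g * (generalizedJordan m n lam α β)ᵀ)
    {k l : Fin q} (hkl : k ≠ l) (a : Fin (s k)) (b : Fin (s l)) (x : Fin (n k a))
    (y : Fin (n l b)) (u v : Fin 2) :
    g (Sum.inr ⟨k, a, x, u⟩) (Sum.inr ⟨l, b, y, v⟩) = 0 := by
  have h := (isChain_lamChain lam α β Complex.I_mul_I k a).pairing_eq_zero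
    (isChain_lamChain lam α β Complex.I_mul_I l b) (castMat_mul_eq hg)
    (fun h => hkl (hLam (by
      have h0 := congrArg Complex.re h
      have h1 := congrArg Complex.im h
      simp at h0 h1
      simp only [h0, h1]))) x y
  rw [pairing_lamChain_lamChain] at h
  have h0 := congrArg Complex.re h
  have h1 := congrArg Complex.im h
  simp at h0 h1
  obtain ⟨c0, c1⟩ := apply_inr_inr_conj hβ hg k l a b x y
  fin_cases u <;> fin_cases v <;> simp only [Fin.zero_eta, Fin.mk_one] <;> linarith

end Algebraic

/-! ### Explicit form of the diagonal blocks -/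

section Analytic

variable {lam : Fin p → ℝ} {α β : Fin q → ℝ} {g : ℝ → Matrix (Idx m n) (Idx m n) ℝ} {I : Set ℝ}

theorem hasDerivAt_castMat
    (hd : ∀ ξ ∈ I, HasMatrixDerivAt g (generalizedJordan m n lam α β * g ξ) ξ) (c : ℝ) :
    ∀ ξ ∈ I, ∀ v w, HasDerivAt (fun t => castMat (c • g t) v w)
      ((castMat (generalizedJordan m n lam α β) * castMat (c • g ξ)) v w) ξ := by
  intro ξ hξ v w
  rw [← castMat_mul, Matrix.mul_smul]
  exact ((hd ξ hξ v w).const_mul c).ofReal_comp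

theorem exists_inl_inl_eq_realX (hIo : IsOpen I) (hIc : IsPreconnected I)
    (hg : ∀ ξ ∈ I, generalizedJordan m n lam α β * g ξ
      = g ξ * (generalizedJordan m n lam α β)ᵀ)
    (hd : ∀ ξ ∈ I, HasMatrixDerivAt g (generalizedJordan m n lam α β * g ξ) ξ)
    (i : Fin p) (a b : Fin (r i)) :
    ∃ C : ℕ → ℝ, ∀ (x : Fin (m i a)) (y : Fin (m i b)), ∀ ξ ∈ I,
      g ξ (Sum.inl ⟨i, a, x⟩) (Sum.inl ⟨i, b, y⟩)
        = realX (min (m i a) (m i b)) (lam i) C ((x : ℕ) + (y : ℕ)) ξ := by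
  obtain ⟨C, D, h⟩ := IsChain.exists_pairing_eq (isChain_realChain lam α β i a)
    (isChain_realChain lam α β i b) hIo hIc (fun ξ => castMat ((1 : ℝ) • g ξ))
    (fun ξ hξ => castMat_mul_eq (by rw [one_smul, hg ξ hξ])) (hasDerivAt_castMat hd 1)
  refine ⟨C, fun x y ξ hξ => ?_⟩
  have h' := congrArg Complex.re (h x y ξ hξ)
  rw [pairing_realChain_realChain] at h'
  -- The real eigenvalue is the case `β = 0`, where the cosine is `1` and the sine is `0`.
  simpa [lamX, realX] using h'

theorem exists_inr_inr_eq_lamZ (hβ : ∀ k, 0 < β k) (hIo : IsOpen I) (hIc : IsPreconnected I)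
    (hg : ∀ ξ ∈ I, generalizedJordan m n lam α β * g ξ
      = g ξ * (generalizedJordan m n lam α β)ᵀ)
    (hd : ∀ ξ ∈ I, HasMatrixDerivAt g (generalizedJordan m n lam α β * g ξ) ξ)
    (k : Fin q) (a b : Fin (s k)) :
    ∃ C D : ℕ → ℝ, ∀ (x : Fin (n k a)) (y : Fin (n k b)) (u v : Fin 2), ∀ ξ ∈ I,
      g ξ (Sum.inr ⟨k, a, x, u⟩) (Sum.inr ⟨k, b, y, v⟩)
        = lamZ (min (n k a) (n k b)) (α k) (β k) C D ((x : ℕ) + (y : ℕ)) ξ u v := by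
  have hμ : (α k : ℂ) + Complex.I * β k = ⟨α k, β k⟩ := by
    apply Complex.ext <;> simp
  have hc := fun b => hμ ▸ isChain_lamChain (m := m) (n := n) lam α β Complex.I_mul_I k b
  obtain ⟨C, D, h⟩ := IsChain.exists_pairing_eq (hc a) (hc b) hIo hIc
    -- On a block `[X, Y; Y, -X]` the pairing is `2 (X + iY)`; the factor `1 / 2` normalizes it.
    (fun ξ => castMat ((1 / 2 : ℝ) • g ξ))
    (fun ξ hξ => castMat_mul_eq (by rw [Matrix.mul_smul, hg ξ hξ, Matrix.smul_mul]))
    (hasDerivAt_castMat hd (1 / 2))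
  refine ⟨C, D, fun x y u v ξ hξ => ?_⟩
  have h' := h x y ξ hξ
  rw [pairing_lamChain_lamChain] at h'
  have h0 := congrArg Complex.re h'
  have h1 := congrArg Complex.im h'
  simp at h0 h1
  obtain ⟨c0, c1⟩ := apply_inr_inr_conj hβ (hg ξ hξ) k k a b x y
  fin_cases u <;> fin_cases v <;> simp [lamZ] <;> linarith

end Analytic

theorem symmetrize_comm {t : ℕ} {γ : Type} (c : Fin t → Fin t → γ) (a b : Fin t) :
    c (min a b) (max a b) = c (min b a) (max b a) := by
  rw [min_comm, max_comm]

end Forward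

end JordanFlow

end

/-! ### The equivalence -/

open JordanFlow in
theorem mainTheorem2 {p q : ℕ} (r : Fin p → ℕ) (s : Fin q → ℕ)
    (m : (i : Fin p) → Fin (r i) → ℕ) (n : (k : Fin q) → Fin (s k) → ℕ)
    (hm : ∀ i a, 0 < m i a) (hn : ∀ k b, 0 < n k b)
    (lam : Fin p → ℝ) (α β : Fin q → ℝ) (hβ : ∀ k, 0 < β k)
    (hlam : Function.Injective lam)
    (hLam : Function.Injective fun k => JordanFlow.Lam (α k) (β k))
    (I : Set ℝ) (hIo : IsOpen I) (hIc : I.OrdConnected)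
    (g : ℝ → Matrix (JordanFlow.Idx m n) (JordanFlow.Idx m n) ℝ) :
    (∀ ξ ∈ I, (g ξ).IsSymm ∧
        JordanFlow.HasMatrixDerivAt g (JordanFlow.generalizedJordan m n lam α β * g ξ) ξ) ↔
      ∃ (B : (i : Fin p) → Fin (r i) → Fin (r i) → ℕ → ℝ)
        (C D : (k : Fin q) → Fin (s k) → Fin (s k) → ℕ → ℝ),
        (∀ i a b, B i a b = B i b a) ∧
        (∀ k a b, C k a b = C k b a) ∧
        (∀ k a b, D k a b = D k b a) ∧
        ∀ ξ ∈ I, g ξ = JordanFlow.diagBlocks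
          (fun i => JordanFlow.gMatrix (m i) (lam i) (B i) ξ)
          (fun k => JordanFlow.gLamMatrix (n k) (α k) (β k) (C k) (D k) ξ) := by
  constructor
  · intro h
    have hg := fun ξ hξ => mul_eq_mul_transpose_of_hasMatrixDerivAt hIo h (ξ := ξ) hξ
    have hd := fun ξ hξ => (h ξ hξ).2
    choose B hB using exists_inl_inl_eq_realX hIo hIc.isPreconnected hg hd
    choose C D hCD using exists_inr_inr_eq_lamZ hβ hIo hIc.isPreconnected hg hd
    -- The constants chosen for `(a, b)` and `(b, a)` are unrelated; those of the ordered pair serve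
    -- both, and symmetry of `g` gives the blocks with `b ≤ a`.
    refine ⟨fun i a b => B i (min a b) (max a b), fun k a b => C k (min a b) (max a b),
      fun k a b => D k (min a b) (max a b), fun i => symmetrize_comm (B i),
      fun k => symmetrize_comm (C k), fun k => symmetrize_comm (D k), fun ξ hξ => ?_⟩
    change g ξ = explicitSolution lam α β _ _ _ ξ
    ext v w
    rcases v with ⟨i, a, x⟩ | ⟨k, a, x, u⟩ <;> rcases w with ⟨j, b, y⟩ | ⟨l, b, y, v⟩
    · by_cases hij : i = j
      · subst hij
        rw [explicitSolution_inl_inl_self]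
        rcases le_total a b with hab | hab
        · rw [min_eq_left hab, max_eq_right hab, hB i a b x y ξ hξ]
        · rw [min_eq_right hab, max_eq_left hab, (h ξ hξ).1.apply, hB i b a y x ξ hξ,
            add_comm (y : ℕ), min_comm (m i b)]
      · rw [explicitSolution_inl_inl_of_ne _ _ _ _ _ _ _ hij,
          apply_inl_inl_eq_zero hlam (hg ξ hξ) hij]
    · rw [explicitSolution_inl_inr, apply_inl_inr_eq_zero hβ (hg ξ hξ)]
    · rw [explicitSolution_inr_inl, (h ξ hξ).1.apply, apply_inl_inr_eq_zero hβ (hg ξ hξ)]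
    · by_cases hkl : k = l
      · subst hkl
        rw [explicitSolution_inr_inr_self]
        rcases le_total a b with hab | hab
        · rw [min_eq_left hab, max_eq_right hab, hCD k a b x y u v ξ hξ]
        · rw [min_eq_right hab, max_eq_left hab, (h ξ hξ).1.apply, hCD k b a y x v u ξ hξ,
            add_comm (y : ℕ), min_comm (n k b), lamZ_comm]
      · rw [explicitSolution_inr_inr_of_ne _ _ _ _ _ _ _ hkl,
          apply_inr_inr_eq_zero hβ hLam (hg ξ hξ) hkl]
  · rintro ⟨B, C, D, hB, hC, hD, h⟩ ξ hξ
    replace h : ∀ ξ ∈ I, g ξ = explicitSolution lam α β B C D ξ := h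
    rw [h ξ hξ]
    refine ⟨explicitSolution_isSymm lam α β B C D hB hC hD ξ, fun v w => ?_⟩
    -- The equality with `g` holds only on `I`, but `I` is open, so the derivative carries over.
    refine (hasMatrixDerivAt_explicitSolution lam α β B C D ξ v w).congr_of_eventuallyEq ?_
    filter_upwards [hIo.mem_nhds hξ] with t ht
    rw [h t ht]
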